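/- Completeness of the Chomsky--Greibach Normal Form (C-GNF) for context-free languages. Consider first-order definite programs over the constants $0,1,[\,]$, the list constructor $[\cdot|\cdot]$, and dyadic predicate symbols: a target symbol $s$, the background symbols $\mathit{one},\mathit{zero},\mathit{empty}$, and countably many invented symbols. Let $B$ be the terminal vocabulary $$\mathit{one}([1|X],X),\qquad \mathit{zero}([0|X],X),\qquad \mathit{empty}(X,X).$$ The C-GNF constrained metarules are - **Identity:** $P(x,y)\leftarrow Q(x,y)$, where $\mathrm{target}(P)\wedge \mathrm{background}(Q)\vee \mathrm{empty}(Q)$; - **Chain:** $P(x,y)\leftarrow Q(x,z),R(z,y)$, where $P\neq Q$, $\mathrm{target}(P)\vee\mathrm{invented}(P)$, $\neg\,\mathrm{target}(Q)$, $\neg\,\mathrm{empty}(Q,R)$, and $\mathrm{invented}(P,Q)\rightarrow P\neq Q$; - **Tri-Chain** (optional): $P(x,y)\leftarrow Q(x,z),R(z,u),S(u,y)$, where $P\neq Q$, $Q\neq R$, $R\neq S$, $\mathrm{target}(P)\vee\mathrm{invented}(P)$, $\neg\,\mathrm{target}(Q)$, $\neg\,\mathrm{empty}(Q,R,S)$,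 and $\mathrm{invented}(P,Q)\rightarrow P\neq Q$. Here $\mathrm{target}(P)$, $\mathrm{background}(P)$, $\mathrm{invented}(P)$, $\mathrm{empty}(P)$ say that $P$ is instantiated to $s$, to one of $\mathit{one},\mathit{zero},\mathit{empty}$, to an invented symbol, or to $\mathit{empty}$, respectively; with several arguments, that this holds for each of them. A set $\mathcal M$ of constrained metarules entails a program $H$ if every clause of $H$ arises from a metarule in $\mathcal M$ by substituting predicate symbols for the second-order variables in accordance with its constraint. Let $\mathcal M$ consist of Identity and Chain, with or without Tri-Chain. Then $\mathcal M$, together with $B$, is a Second-Order Definite Normal Form for the context-free languages over $\{0,1\}$: for every context-free language $L\subseteq\{0,1\}^*$ there is a finite program $H$ entailed by $\mathcal M$ such that for all ground terms $t,u$ $$B\cup H\models s(t,u)\iff t=[b_1,\dots,b_n\,|\,u]\text{ for some } b_1\cdots b_n\in L,$$ where $\models$ is first-order logical consequence (so in particular $B\cup H\models s([b_1,\dots,b_n],[\,])$ iff $b_1\cdots b_n\in L$). Moreover, for every program $H$ entailed by $\mathcal M$, $B\cup H$ is a definite clause grammar (DCG): each of its clauses has the form $p(x_0,x_n)\leftarrow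 q_1(x_0,x_1),\dots,q_n(x_{n-1},x_n)$ with $n\ge 0$, or $p([b|x],x)$ with $b\in\{0,1\}$. This holds for both readings of the constraints: the narrow one, in which Identity requires $\mathrm{target}(P)\wedge(\mathrm{background}(Q)\vee\mathrm{empty}(Q))$ and $\neg\,\mathrm{empty}(Q,R,\dots)$ says that none of the listed symbols is $\mathit{empty}$; and the wide one, in which Identity requires $(\mathrm{target}(P)\wedge\mathrm{background}(Q))\vee\mathrm{empty}(Q)$ and $\neg\,\mathrm{empty}(Q,R,\dots)$ says that not all of them are. -/

import Mathlib

namespace CGNF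

/-! ## First-order definite programs over bit-strings -/

/-- Function symbols: the constants `0`, `1`, `[]` and the list constructor `[_|_]`. -/
inductive Func : ℕ → Type
  | zero : Func 0
  | one : Func 0
  | nil : Func 0
  | cons : Func 2

/-- Predicate symbols, all dyadic: the target predicate, the symbols of the background theory,
and an unlimited supply of invented predicate symbols. -/
inductive Pred : Type
  | target : Pred
  | zero : Pred
  | one : Pred
  | empty : Pred
  | invented (n : ℕ) : Pred

/-- Relation symbols: every predicate symbol has arity two. -/
inductive Rel : ℕ → Type
  | sym (p : Pred) : Rel 2

/-- The first-order language of the programs. -/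
abbrev lang : FirstOrder.Language.{0, 0} where
  Functions := Func
  Relations := Rel

/-- Terms with variables from `α`. -/
abbrev Tm (α : Type) : Type := lang.Term α

/-- The constant of a bit. -/
def bitTm {α : Type} : Bool → Tm α
  | false => FirstOrder.Language.Term.func (L := lang) Func.zero ![]
  | true => FirstOrder.Language.Term.func (L := lang) Func.one ![]

/-- The empty list `[]`. -/
def nilTm {α : Type} : Tm α := FirstOrder.Language.Term.func (L := lang) Func.nil ![]

/-- The list term `[a|b]`. -/
def consTm {α : Type} (a b : Tm α) : Tm α :=
  FirstOrder.Language.Term.func (L := lang) Func.cons ![a, b]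

/-- The variable with index `i`. -/
def varTm (i : ℕ) : Tm ℕ := FirstOrder.Language.Term.var i

/-- Atoms `p(fst, snd)` whose terms have variables from `α`. -/
structure Atom (α : Type) where
  pred : Pred
  fst : Tm α
  snd : Tm α

/-- Truth of an atom in a structure under a valuation of the variables. -/
def Atom.Holds {α : Type} (M : Type) [lang.Structure M] (a : Atom α) (v : α → M) : Prop :=
  FirstOrder.Language.Structure.RelMap (L := lang) (M := M) (Rel.sym a.pred)
    ![a.fst.realize v, a.snd.realize v]

/-- Definite clauses `head ← body`, with all variables implicitly universally quantified. -/
structure Clause where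
  head : Atom ℕ
  body : List (Atom ℕ)

/-- Truth of a definite clause in a structure. -/
def Clause.Holds (M : Type) [lang.Structure M] (c : Clause) : Prop :=
  ∀ v : ℕ → M, (∀ a ∈ c.body, a.Holds M v) → c.head.Holds M v

/-- `M` is a model of the set of clauses `S`. -/
def IsModel (M : Type) [lang.Structure M] (S : Set Clause) : Prop :=
  ∀ c ∈ S, c.Holds M

/-- Logical consequence `S ⊨ c` for a clause `c`: every (non-empty) first-order model of `S`, not
only the Herbrand ones, satisfies `c`. (The language is countable, so models in `Type` suffice.) -/
def EntailsClause (S : Set Clause) (c : Clause) : Prop :=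
  ∀ (M : Type) [lang.Structure M] [Nonempty M], IsModel M S → c.Holds M

/-- Logical consequence `S ⊨ a` for a ground atom `a`. -/
def EntailsAtom (S : Set Clause) (a : Atom Empty) : Prop :=
  ∀ (M : Type) [lang.Structure M] [Nonempty M], IsModel M S → a.Holds M Empty.elim

/-! ## Definite clause grammars -/

/-- The literals `q₁(xᵢ, xᵢ₊₁), q₂(xᵢ₊₁, xᵢ₊₂), …`. -/
def seqBody : ℕ → List Pred → List (Atom ℕ)
  | _, [] => []
  | i, q :: qs => ⟨q, varTm i, varTm (i + 1)⟩ :: seqBody (i + 1) qs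

/-- The clause `p(x₀, xₙ) ← q₁(x₀, x₁), …, qₙ(xₙ₋₁, xₙ)` of the grammar rule `p → q₁, …, qₙ`.
For `n = 0` this is `p(x, x)`, the clause of the rule `p → []`. -/
def seqClause (p : Pred) (qs : List Pred) : Clause where
  head := ⟨p, varTm 0, varTm qs.length⟩
  body := seqBody 0 qs

/-- The clause `p([b|x], x)` of the grammar rule `p → [b]`. -/
def terminalClause (p : Pred) (b : Bool) : Clause where
  head := ⟨p, consTm (bitTm b) (varTm 0), varTm 0⟩
  body := []

/-- A program is a definite clause grammar if all its clauses translate grammar rules. -/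
def IsDCG (S : Set Clause) : Prop :=
  ∀ c ∈ S, (∃ p qs, c = seqClause p qs) ∨ ∃ p b, c = terminalClause p b

/-- The terminal vocabulary as a background theory:
`one([1|X], X)`, `zero([0|X], X)`, `empty(X, X)`. -/
def vocabulary : Set Clause :=
  {terminalClause Pred.one true, terminalClause Pred.zero false, seqClause Pred.empty []}

/-! ## Constrained metarules -/

/-- A second-order atom `P(x, y)`: a second-order variable and two first-order variables, all
given by their indices. -/
structure MetaAtom where
  pvar : ℕ
  fst : ℕ
  snd : ℕ

/-- Metarules: second-order definite clauses. -/
structure Metarule where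
  head : MetaAtom
  body : List MetaAtom

/-- Instantiation of the second-order variable of an atom. -/
def MetaAtom.inst (θ : ℕ → Pred) (a : MetaAtom) : Atom ℕ :=
  ⟨θ a.pvar, varTm a.fst, varTm a.snd⟩

/-- The first-order definite clause obtained by instantiating the second-order variables. -/
def Metarule.inst (θ : ℕ → Pred) (M : Metarule) : Clause where
  head := M.head.inst θ
  body := M.body.map (MetaAtom.inst θ)

/-- The symbols of the examples. -/
def targetSyms : Set Pred := {Pred.target}

/-- The symbols of the background theory; they include the symbol `empty`. -/
def backgroundSyms : Set Pred := {Pred.zero, Pred.one, Pred.empty}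

/-- The invented symbols. -/
def inventedSyms : Set Pred := Set.range Pred.invented

/-- Constraints on the instantiation of second-order variables. -/
inductive Constraint : Type
  | eq (P Q : ℕ)
  | ne (P Q : ℕ)
  | target (Ps : List ℕ)
  | invented (Ps : List ℕ)
  | background (Ps : List ℕ)
  | empty (Ps : List ℕ)
  | inventedNe (P Q : ℕ)
  | and (C D : Constraint)
  | or (C D : Constraint)
  | not (C : Constraint)

/-- The interpretation of constraints. -/
def Constraint.Sat (θ : ℕ → Pred) : Constraint → Prop
  | .eq P Q => θ P = θ Q
  | .ne P Q => θ P ≠ θ Q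
  | .target Ps => ∀ P ∈ Ps, θ P ∈ targetSyms
  | .invented Ps => ∀ P ∈ Ps, θ P ∈ inventedSyms
  | .background Ps => ∀ P ∈ Ps, θ P ∈ backgroundSyms
  | .empty Ps => ∀ P ∈ Ps, θ P = Pred.empty
  | .inventedNe P Q => θ P ∈ inventedSyms → θ Q ∈ inventedSyms → θ P ≠ θ Q
  | .and C D => C.Sat θ ∧ D.Sat θ
  | .or C D => C.Sat θ ∨ D.Sat θ
  | .not C => ¬ C.Sat θ

/-- A metarule together with a constraint on it. -/
structure ConstrainedMetarule where
  rule : Metarule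
  constraint : Constraint

/-- The first-order clauses that are instances of a metarule of `𝓜` in accordance with its
constraint. -/
def instances (𝓜 : Set ConstrainedMetarule) : Set Clause :=
  {c | ∃ M ∈ 𝓜, ∃ θ : ℕ → Pred, M.constraint.Sat θ ∧ c = M.rule.inst θ}

/-- `𝓜 ⊨ H` for a set `𝓜` of constrained metarules and a first-order program `H`: every clause of
`H` is obtained from a metarule by a substitution of predicate symbols for the second-order
variables that satisfies the constraint. -/
def MetaEntails (𝓜 : Set ConstrainedMetarule) (H : Set Clause) : Prop :=
  H ⊆ instances 𝓜

/-- If every constrained instance of the metarules holds, so does every program that they entail. -/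
theorem MetaEntails.entailsClause {𝓜 : Set ConstrainedMetarule} {H : Set Clause}
    (h : MetaEntails 𝓜 H) : ∀ c ∈ H, EntailsClause (instances 𝓜) c :=
  fun c hc _ _ _ hM => hM c (h hc)

/-! ## Second-order definite normal forms -/

/-- Ground terms. -/
abbrev GTm : Type := Tm Empty

/-- A Herbrand interpretation over the Herbrand base of the target predicate, given by its true
atoms: the pair `(t, u)` stands for the ground atom `target(t, u)`. -/
abbrev Interp : Type := Set (GTm × GTm)

/-- The finite definite programs that entail all atoms of the Herbrand base of the target that are
true in `I`, and none of those that are false in `I`. -/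
def programsFor (I : Interp) : Set (Set Clause) :=
  {S | S.Finite ∧
    (∀ a ∈ I, EntailsAtom S ⟨Pred.target, a.1, a.2⟩) ∧
    (∀ a ∉ I, ¬ EntailsAtom S ⟨Pred.target, a.1, a.2⟩)}

/-- With the background theory `B`, the constrained metarules `𝓜` are a second-order definite
normal form that is complete for the class `𝓘` of interpretations: for every interpretation in the
class they entail a program which, with `B`, defines the target under that interpretation. -/
def IsSONF (B : Set Clause) (𝓜 : Set ConstrainedMetarule) (𝓘 : Set Interp) : Prop :=
  ∀ I ∈ 𝓘, ∃ H : Set Clause, MetaEntails 𝓜 H ∧ B ∪ H ∈ programsFor I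

/-- The term `[b₁, …, bₙ | t]` for a bit-string `b₁ … bₙ`. -/
def prepend : List Bool → GTm → GTm
  | [], t => t
  | b :: w, t => consTm (bitTm b) (prepend w t)

/-- The interpretation that a language gives to the target by difference lists: `target(t, u)` is
true iff `t` is a string of the language followed by `u`. In particular `target(w, [])` is true iff
the string `w` is in the language. -/
def languageInterp (L : Language Bool) : Interp :=
  {a | ∃ w ∈ L, a.1 = prepend w a.2}

/-- The interpretations given by the context-free languages of bit-strings. -/
def contextFreeInterps : Set Interp :=
  {I | ∃ L : Language Bool, L.IsContextFree ∧ I = languageInterp L}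

/-! ## The Chomsky-Greibach normal form

The second-order variables `P, Q, R, S` have the indices `0, 1, 2, 3`. The first-order variables
are numbered in the order in which the body passes through them. Two places in the constraints can
be read in a narrow and in a wide sense; `narrow` selects the reading. -/

/-- `P(x,y) ← Q(x,y) : target(P) ∧ background(Q) ∨ empty(Q)`.
The narrow reading brackets `∨` first, the wide one brackets `∧` first. -/
def identity (narrow : Bool) : ConstrainedMetarule where
  rule := ⟨⟨0, 0, 1⟩, [⟨1, 0, 1⟩]⟩
  constraint := bif narrow
    then .and (.target [0]) (.or (.background [1]) (.empty [1]))
    else .or (.and (.target [0]) (.background [1])) (.empty [1])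

/-- `not(empty(P₁,…,Pₙ))`. Narrow reading: none of the `Pᵢ` is `empty`; wide reading: not all of
them are. -/
def notEmpty (narrow : Bool) (Ps : List ℕ) : Constraint :=
  bif narrow
    then Ps.foldr (fun P C => .and (.not (.empty [P])) C) (.target [])
    else .not (.empty Ps)

/-- `P(x,y) ← Q(x,z), R(z,y) : P ≠ Q ∧ (target(P) ∨ invented(P)) ∧ not(target(Q)) ∧
not(empty(Q,R)) ∧ (invented(P,Q) → P ≠ Q)`. -/
def chain (narrow : Bool) : ConstrainedMetarule where
  rule := ⟨⟨0, 0, 2⟩, [⟨1, 0, 1⟩, ⟨2, 1, 2⟩]⟩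
  constraint :=
    .and (.ne 0 1) <| .and (.or (.target [0]) (.invented [0])) <| .and (.not (.target [1])) <|
      .and (notEmpty narrow [1, 2]) (.inventedNe 0 1)

/-- `P(x,y) ← Q(x,z), R(z,u), S(u,y) : P ≠ Q ∧ Q ≠ R ∧ R ≠ S ∧ (target(P) ∨ invented(P)) ∧
not(target(Q)) ∧ not(empty(Q,R,S)) ∧ (invented(P,Q) → P ≠ Q)`. -/
def triChain (narrow : Bool) : ConstrainedMetarule where
  rule := ⟨⟨0, 0, 3⟩, [⟨1, 0, 1⟩, ⟨2, 1, 2⟩, ⟨3, 2, 3⟩]⟩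
  constraint :=
    .and (.ne 0 1) <| .and (.ne 1 2) <| .and (.ne 2 3) <|
      .and (.or (.target [0]) (.invented [0])) <| .and (.not (.target [1])) <|
      .and (notEmpty narrow [1, 2, 3]) (.inventedNe 0 1)

/-- The Chomsky-Greibach metarules: Identity, Chain and, optionally, Tri-Chain. -/
def metarules (narrow withTriChain : Bool) : Set ConstrainedMetarule :=
  {M | M = identity narrow ∨ M = chain narrow ∨ (withTriChain = true ∧ M = triChain narrow)}

end CGNF

namespace CGNF

open FirstOrder

/-! ## Words derived from sentential forms -/

/-! No grammar is normalised. For a grammar of `L`, take all sublists of the rule outputs and of the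
initial form: finitely many sentential forms, each with the language it derives. In this finite
family, every word of length at least two splits into two non-empty words from members `A`, `B` with
`A * B` inside the given language (`exists_finite_splitsIn`).

The program is then defined semantically: assign a language to each symbol and take every Identity
and Chain clause over finitely many symbols that is valid for this assignment. Soundness is
immediate, since the assignment yields a Herbrand model (`herbrand_isModel`). Completeness is an
induction on word length in an arbitrary model (`predRel_prependElt`), the two factors of a split
being shorter.

The constraints dictate the assignment. Chain bodies avoid `empty`, and letters are left to `zero`
and `one`, so invented symbols carry only words of length at least two; the empty word and the
letters of `L` reach the target through Identity. As Chain demands `P ≠ Q`, each language has two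
invented symbols, so that a left-recursive rule can use the other copy. -/

/-- `Yields g α w`: the sentential form `α` derives the terminal word `w` in `g`. -/
inductive Yields {T : Type} (g : ContextFreeGrammar T) : List (Symbol T g.NT) → List T → Prop
  | nil : Yields g [] []
  | terminal {t : T} {α : List (Symbol T g.NT)} {w : List T} (h : Yields g α w) :
      Yields g (.terminal t :: α) (t :: w)
  | nonterminal {r : ContextFreeRule T g.NT} {α : List (Symbol T g.NT)} {u w : List T}
      (hr : r ∈ g.rules) (hu : Yields g r.output u) (hw : Yields g α w) :
      Yields g (.nonterminal r.input :: α) (u ++ w)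

namespace Yields

variable {T : Type} {g : ContextFreeGrammar T}

theorem append {α β : List (Symbol T g.NT)} {u v : List T} (hu : Yields g α u)
    (hv : Yields g β v) : Yields g (α ++ β) (u ++ v) := by
  induction hu with
  | nil => simpa
  | terminal _ ih => exact .terminal ih
  | nonterminal hr h₁ _ _ ih =>
    rw [List.append_assoc]
    exact .nonterminal hr h₁ ih

theorem exists_of_append {α β : List (Symbol T g.NT)} {w : List T} (h : Yields g (α ++ β) w) :
    ∃ u v, w = u ++ v ∧ Yields g α u ∧ Yields g β v := by
  generalize hγ : α ++ β = γ at h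
  induction h generalizing α with
  | nil =>
    obtain ⟨rfl, rfl⟩ := List.append_eq_nil_iff.1 hγ
    exact ⟨[], [], rfl, .nil, .nil⟩
  | @terminal t γ w h ih =>
    rcases α with _ | ⟨x, α⟩
    · obtain rfl : β = _ := hγ
      exact ⟨[], _, rfl, .nil, .terminal h⟩
    · obtain ⟨rfl, h'⟩ := List.cons.inj hγ
      obtain ⟨u, v, rfl, hu, hv⟩ := ih h'
      exact ⟨t :: u, v, rfl, .terminal hu, hv⟩
  | @nonterminal r γ u w hr h₁ h₂ _ ih =>
    rcases α with _ | ⟨x, α⟩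
    · obtain rfl : β = _ := hγ
      exact ⟨[], _, rfl, .nil, .nonterminal hr h₁ h₂⟩
    · obtain ⟨rfl, h'⟩ := List.cons.inj hγ
      obtain ⟨u', v, rfl, hu, hv⟩ := ih h'
      exact ⟨u ++ u', v, (List.append_assoc ..).symm, .nonterminal hr h₁ hu, hv⟩

theorem map_terminal (w : List T) : Yields g (w.map Symbol.terminal) w := by
  induction w with
  | nil => exact .nil
  | cons t w ih => exact .terminal ih

theorem derives {α : List (Symbol T g.NT)} {w : List T} (h : Yields g α w) :
    g.Derives α (w.map Symbol.terminal) := by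
  induction h with
  | nil => exact .refl _
  | terminal _ ih => exact ih.append_left [_]
  | @nonterminal r α u w hr _ _ ih₁ ih₂ =>
    rw [List.map_append]
    have h : g.Produces (.nonterminal r.input :: α) (r.output ++ α) := ⟨r, hr, .head α⟩
    exact h.trans_derives ((ih₁.append_right α).trans (ih₂.append_left _))

/-- The word of `β` is cut along the rewritten occurrence; the piece derived from the rule output
becomes a piece derived from the nonterminal. -/
theorem of_produces {α β : List (Symbol T g.NT)} {w : List T} (h : g.Produces α β)
    (hw : Yields g β w) : Yields g α w := by
  obtain ⟨r, hr, h⟩ := h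
  obtain ⟨p, q, rfl, rfl⟩ := h.exists_parts
  obtain ⟨u, v, rfl, hu, hv⟩ := hw.exists_of_append
  obtain ⟨u₁, u₂, rfl, hu₁, hu₂⟩ := hu.exists_of_append
  refine (hu₁.append ?_).append hv
  simpa using Yields.nonterminal hr hu₂ .nil

theorem of_derives {α : List (Symbol T g.NT)} {w : List T}
    (h : g.Derives α (w.map Symbol.terminal)) : Yields g α w := by
  induction h using Relation.ReflTransGen.head_induction_on with
  | refl => exact map_terminal w
  | head h _ ih => exact of_produces h ih

end Yields

/-- The language of the terminal words that a sentential form derives. -/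
def formLanguage {T : Type} (g : ContextFreeGrammar T) (α : List (Symbol T g.NT)) : Language T :=
  {w | Yields g α w}

theorem mem_formLanguage {T : Type} {g : ContextFreeGrammar T} {α : List (Symbol T g.NT)}
    {w : List T} : w ∈ formLanguage g α ↔ Yields g α w := Iff.rfl

theorem formLanguage_initial {T : Type} (g : ContextFreeGrammar T) :
    formLanguage g [.nonterminal g.initial] = g.language := by
  ext w
  exact ⟨fun h => (mem_formLanguage.1 h).derives, fun h => Yields.of_derives h⟩

theorem formLanguage_mul_le {T : Type} (g : ContextFreeGrammar T) (α β : List (Symbol T g.NT)) :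
    formLanguage g α * formLanguage g β ≤ formLanguage g (α ++ β) := by
  intro w hw
  obtain ⟨u, hu, v, hv, rfl⟩ := Language.mem_mul.1 hw
  exact Yields.append hu hv

/-! ## Families of languages with binary decompositions -/

/-- `w` is the concatenation of non-empty words from two languages `A` and `B` of the family `𝓛`
such that all concatenations of words from `A` and `B` are in `L`. -/
def SplitsIn {T : Type} (𝓛 : Set (Language T)) (L : Language T) (w : List T) : Prop :=
  ∃ A ∈ 𝓛, ∃ B ∈ 𝓛, A * B ≤ L ∧ ∃ u ∈ A, ∃ v ∈ B, u ≠ [] ∧ v ≠ [] ∧ u ++ v = w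

theorem SplitsIn.mono {T : Type} {𝓛 : Set (Language T)} {L L' : Language T} {w : List T}
    (h : SplitsIn 𝓛 L w) (hL : L ≤ L') : SplitsIn 𝓛 L' w := by
  obtain ⟨A, hA, B, hB, hAB, h⟩ := h
  exact ⟨A, hA, B, hB, hAB.trans hL, h⟩

/-- Cut the form after its first symbol. If one side derives the empty word, no cut is made there:
the induction moves on to the rest of the form, or to the output of the rule applied to the first
symbol. This absorbs empty and unit productions. -/
theorem Yields.splitsIn {T : Type} {g : ContextFreeGrammar T}
    {N : Set (List (Symbol T g.NT))} (hsub : ∀ α ∈ N, ∀ β, List.Sublist β α → β ∈ N)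
    (hout : ∀ r ∈ g.rules, r.output ∈ N) {α : List (Symbol T g.NT)} {w : List T}
    (h : Yields g α w) (hα : α ∈ N) (hw : 2 ≤ w.length) :
    SplitsIn (formLanguage g '' N) (formLanguage g α) w := by
  induction h with
  | nil => simp at hw
  | @terminal t α w h ih =>
    refine ⟨_, ⟨[.terminal t], hsub _ hα _ (by simp), rfl⟩, _, ⟨α, hsub _ hα _ (by simp), rfl⟩,
      formLanguage_mul_le g _ _, [t], .terminal .nil, w, h, by simp, ?_, rfl⟩
    rintro rfl
    simp at hw
  | @nonterminal r α u w hr h₁ h₂ ih₁ ih₂ =>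
    have hα' : α ∈ N := hsub _ hα _ (by simp)
    rcases eq_or_ne u [] with rfl | hu
    · exact (ih₂ hα' hw).mono fun v hv => Yields.nonterminal hr h₁ hv
    rcases eq_or_ne w [] with rfl | hw'
    · rw [List.append_nil] at hw ⊢
      refine (ih₁ (hout r hr) hw).mono fun v hv => ?_
      exact List.append_nil v ▸ Yields.nonterminal hr hv h₂
    refine ⟨_, ⟨[.nonterminal r.input], hsub _ hα _ (by simp), rfl⟩, _, ⟨α, hα', rfl⟩,
      formLanguage_mul_le g _ _, u, ?_, w, h₂, hu, hw', rfl⟩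
    simpa [mem_formLanguage] using Yields.nonterminal hr h₁ .nil

/-- A context-free language belongs to a finite family of languages in which words of length at
least two split. -/
theorem exists_finite_splitsIn {T : Type} {L : Language T} (hL : L.IsContextFree) :
    ∃ 𝓛 : Set (Language T), 𝓛.Finite ∧ L ∈ 𝓛 ∧
      ∀ A ∈ 𝓛, ∀ w ∈ A, 2 ≤ w.length → SplitsIn 𝓛 A w := by
  obtain ⟨g, rfl⟩ := hL
  let base : Set (List (Symbol T g.NT)) :=
    insert [.nonterminal g.initial] (ContextFreeRule.output '' (g.rules : Set _))
  -- Closure under sublists provides the heads and tails at which forms are cut, and keeps the set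
  -- finite.
  let N : Set (List (Symbol T g.NT)) := {α | ∃ β ∈ base, List.Sublist α β}
  have hbase : base ⊆ N := fun β hβ => ⟨β, hβ, List.Sublist.refl β⟩
  have hfin : N.Finite := by
    have h : base.Finite := (g.rules.finite_toSet.image _).insert _
    refine (h.biUnion fun β _ => List.finite_toSet β.sublists).subset ?_
    rintro α ⟨β, hβ, h⟩
    exact Set.mem_biUnion hβ (List.mem_sublists.2 h)
  refine ⟨formLanguage g '' N, hfin.image _,
    ⟨_, hbase (Set.mem_insert _ _), formLanguage_initial g⟩, ?_⟩
  rintro _ ⟨α, hα, rfl⟩ w hw hlen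
  refine Yields.splitsIn ?_ ?_ (mem_formLanguage.1 hw) hα hlen
  · rintro α ⟨γ, hγ, h⟩ β hβ
    exact ⟨γ, hγ, hβ.trans h⟩
  · exact fun r hr => hbase (Set.mem_insert_of_mem _ ⟨r, hr, rfl⟩)

/-! ## The program of a family of languages -/

/-- The language of a predicate symbol, for the target language `L` and the family `f`. The
invented symbols `2 * i` and `2 * i + 1` stand for the words of `f i` of length at least two. -/
def predLanguage (L : Language Bool) (f : ℕ → Language Bool) : Pred → Language Bool
  | .target => L
  | .zero => {[false]}
  | .one => {[true]}
  | .empty => {[]}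
  | .invented n => {w | w ∈ f (n / 2) ∧ 2 ≤ w.length}

/-- The symbols that the program of a family of `m` languages uses in the bodies of its chain
clauses. -/
def bodySyms (m : ℕ) : Set Pred :=
  {Pred.zero, Pred.one} ∪ Pred.invented '' Set.Iio (2 * m)

/-- The identity clauses and chain clauses that are valid for the languages of the symbols. -/
def program (L : Language Bool) (f : ℕ → Language Bool) (m : ℕ) : Set Clause :=
  {c | (∃ q ∈ backgroundSyms, predLanguage L f q ≤ L ∧ c = seqClause .target [q]) ∨
    ∃ p ∈ insert Pred.target (Pred.invented '' Set.Iio (2 * m)), ∃ q ∈ bodySyms m,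
      ∃ r ∈ bodySyms m, p ≠ q ∧
        predLanguage L f q * predLanguage L f r ≤ predLanguage L f p ∧ c = seqClause p [q, r]}

theorem finite_program (L : Language Bool) (f : ℕ → Language Bool) (m : ℕ) :
    (program L f m).Finite := by
  have hinv : (Pred.invented '' Set.Iio (2 * m)).Finite := (Set.finite_Iio _).image _
  have hbody : (bodySyms m).Finite := (Set.toFinite _).union hinv
  have hback : backgroundSyms.Finite := Set.toFinite {Pred.zero, Pred.one, Pred.empty}
  refine ((hback.image fun q => seqClause .target [q]).union
    (((hinv.insert Pred.target).prod (hbody.prod hbody)).image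
      fun x => seqClause x.1 [x.2.1, x.2.2])).subset ?_
  rintro c (⟨q, hq, -, rfl⟩ | ⟨p, hp, q, hq, r, hr, -, -, rfl⟩)
  · exact .inl ⟨q, hq, rfl⟩
  · exact .inr ⟨(p, q, r), ⟨hp, hq, hr⟩, rfl⟩

/-- The clauses satisfy the narrow constraints, hence also the wide ones, and Tri-Chain is never
needed. -/
theorem metaEntails_program (narrow withTriChain : Bool) (L : Language Bool)
    (f : ℕ → Language Bool) (m : ℕ) :
    MetaEntails (metarules narrow withTriChain) (program L f m) := by
  rintro c (⟨q, hq, -, rfl⟩ | ⟨p, hp, q, hq, r, hr, hpq, -, rfl⟩)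
  · refine ⟨identity narrow, .inl rfl, fun | 0 => .target | _ => q, ?_, rfl⟩
    cases narrow <;> simp [identity, Constraint.Sat, targetSyms, hq]
  · refine ⟨chain narrow, .inr (.inl rfl), fun | 0 => p | 1 => q | _ => r, ?_, rfl⟩
    have hp' : p ∈ targetSyms ∨ p ∈ inventedSyms := by
      rcases hp with rfl | ⟨n, -, rfl⟩
      · exact .inl rfl
      · exact .inr ⟨n, rfl⟩
    have hbody : ∀ x ∈ bodySyms m, x ∉ targetSyms ∧ x ≠ Pred.empty := by
      rintro x ((rfl | rfl) | ⟨n, -, rfl⟩) <;> simp [targetSyms]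
    cases narrow <;> simp [chain, notEmpty, Constraint.Sat, hpq, hp', hbody q hq, hbody r hr]

/-! ## Soundness -/

/-- The Herbrand structure in which a predicate symbol `p` holds between `[b₁, …, bₙ | u]` and `u`
for the words `b₁ … bₙ` of the language `D p`. -/
abbrev herbrand (D : Pred → Language Bool) : lang.Structure GTm where
  funMap := fun F a => Language.Term.func F a
  RelMap := fun R a => match R with
    | .sym p => ∃ w ∈ D p, a 0 = prepend w (a 1)

theorem realize_herbrand (D : Pred → Language Bool) (t : GTm) (v : Empty → GTm) :
    letI := herbrand D
    t.realize v = t := by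
  induction t with
  | var i => exact i.elim
  | func F a ih =>
    let := herbrand D
    exact congrArg (Language.Term.func F) (funext ih)

theorem prepend_append (u v : List Bool) (t : GTm) :
    prepend (u ++ v) t = prepend u (prepend v t) := by
  induction u with
  | nil => rfl
  | cons b u ih => exact congrArg (consTm (bitTm b)) ih

theorem realize_consTm_bitTm {α M : Type} [lang.Structure M] (b : Bool) (t : Tm α) (v : α → M) :
    (consTm (bitTm b) t).realize v =
      Language.Structure.funMap (L := lang) Func.cons
        ![(bitTm b : GTm).realize Empty.elim, t.realize v] := by
  have hb : (bitTm b : Tm α).realize v = (bitTm b : GTm).realize (Empty.elim : Empty → M) := by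
    cases b <;> exact congrArg _ (funext fun i => i.elim0)
  rw [← hb]
  refine congrArg (Language.Structure.funMap (L := lang) Func.cons) (funext fun i => ?_)
  fin_cases i <;> rfl

/-- Concatenation of words is composition of the difference-list relations, so the inclusion
required of each clause is its truth. -/
theorem herbrand_isModel (L : Language Bool) (f : ℕ → Language Bool) (m : ℕ) :
    letI := herbrand (predLanguage L f)
    IsModel GTm (vocabulary ∪ program L f m) := by
  let := herbrand (predLanguage L f)
  have hterm : ∀ p b, [b] ∈ predLanguage L f p → (terminalClause p b).Holds GTm := by
    intro p b hb v _
    refine ⟨[b], hb, ?_⟩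
    change (consTm (bitTm b) (varTm 0)).realize v = consTm (bitTm b) (v 0)
    rw [realize_consTm_bitTm, realize_herbrand]
    rfl
  rintro c ((rfl | rfl | rfl) | ⟨q, -, hq, rfl⟩ | ⟨p, -, q, -, r, -, -, hqr, rfl⟩)
  · exact hterm _ _ rfl
  · exact hterm _ _ rfl
  · exact fun v _ => ⟨[], rfl, rfl⟩
  · intro v hv
    obtain ⟨w, hw, h⟩ := hv _ (List.mem_singleton.2 rfl)
    exact ⟨w, hq hw, h⟩
  · intro v hv
    obtain ⟨w₁, hw₁, h₁⟩ := hv ⟨q, varTm 0, varTm 1⟩ (by simp [seqClause, seqBody])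
    obtain ⟨w₂, hw₂, h₂⟩ := hv ⟨r, varTm 1, varTm 2⟩ (by simp [seqClause, seqBody])
    refine ⟨w₁ ++ w₂, hqr (Language.append_mem_mul hw₁ hw₂), ?_⟩
    rw [prepend_append]
    exact h₁.trans (congrArg (prepend w₁) h₂)

theorem mem_languageInterp_of_entails {L : Language Bool} {f : ℕ → Language Bool} {m : ℕ}
    {a : GTm × GTm} (h : EntailsAtom (vocabulary ∪ program L f m) ⟨.target, a.1, a.2⟩) :
    a ∈ languageInterp L := by
  let := herbrand (predLanguage L f)
  have : Nonempty GTm := ⟨a.1⟩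
  obtain ⟨w, hw, h⟩ := h GTm (herbrand_isModel L f m)
  refine ⟨w, hw, ?_⟩
  change a.1.realize Empty.elim = prepend w (a.2.realize Empty.elim) at h
  rwa [realize_herbrand, realize_herbrand] at h

/-! ## Completeness -/

section Model

variable {M : Type} [lang.Structure M]

/-- The relation that interprets a predicate symbol. -/
def PredRel (p : Pred) (x y : M) : Prop :=
  Language.Structure.RelMap (L := lang) (Rel.sym p) ![x, y]

/-- The element denoted by `[b₁, …, bₙ | x]`. -/
def prependElt : List Bool → M → M
  | [], x => x
  | b :: w, x => Language.Structure.funMap (L := lang) Func.cons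
      ![(bitTm b : GTm).realize Empty.elim, prependElt w x]

theorem prependElt_append (u v : List Bool) (x : M) :
    prependElt (u ++ v) x = prependElt u (prependElt v x) := by
  induction u with
  | nil => rfl
  | cons b u ih => simp only [List.cons_append, prependElt, ih]

theorem realize_prepend (w : List Bool) (t : GTm) :
    (prepend w t).realize (Empty.elim : Empty → M) = prependElt w (t.realize Empty.elim) := by
  induction w with
  | nil => rfl
  | cons b w ih => rw [prepend, realize_consTm_bitTm, ih, prependElt]

theorem predRel_of_terminalClause {p : Pred} {b : Bool} (h : (terminalClause p b).Holds M) (x : M) :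
    PredRel p (prependElt [b] x) x := by
  have := h (fun _ => x) (by simp [terminalClause])
  simp only [Atom.Holds, terminalClause, realize_consTm_bitTm] at this
  exact this

theorem predRel_of_seqClause_one {p q : Pred} (h : (seqClause p [q]).Holds M) {x y : M}
    (hq : PredRel q x y) : PredRel p x y := by
  refine h (fun | 0 => x | _ => y) fun a ha => ?_
  obtain rfl := List.mem_singleton.1 ha
  exact hq

theorem predRel_of_seqClause_two {p q r : Pred} (h : (seqClause p [q, r]).Holds M) {x y z : M}
    (hq : PredRel q x y) (hr : PredRel r y z) : PredRel p x z := by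
  refine h (fun | 0 => x | 1 => y | _ => z) fun a ha => ?_
  simp only [seqClause, seqBody, List.mem_cons, List.not_mem_nil, or_false] at ha
  rcases ha with rfl | rfl
  · exact hq
  · exact hr

end Model

/-- A non-empty word of `f i` is in the language of a body symbol that differs from a given symbol
in the head and is valid for `f i`. -/
theorem exists_bodySym (L : Language Bool) {f : ℕ → Language Bool} {m i : ℕ} (hi : i < m)
    {w : List Bool} (hw : w ∈ f i) (hne : w ≠ []) {p : Pred} (hp : p ≠ .zero ∧ p ≠ .one) :
    ∃ q ∈ bodySyms m, p ≠ q ∧ w ∈ predLanguage L f q ∧ predLanguage L f q ≤ f i := by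
  have hbit : ∀ b, w = [b] → predLanguage L f (bif b then .one else .zero) ≤ f i := by
    rintro b rfl v hv
    cases b <;> exact (show v = _ from hv) ▸ hw
  rcases w with _ | ⟨b, _ | ⟨b', w⟩⟩
  · exact absurd rfl hne
  · refine ⟨bif b then .one else .zero, ?_, ?_, ?_, hbit b rfl⟩
    · cases b <;> simp [bodySyms]
    · cases b <;> simp [hp]
    · cases b <;> rfl
  · have key : ∀ n, n / 2 = i → p ≠ .invented n →
        ∃ q ∈ bodySyms m, p ≠ q ∧ b :: b' :: w ∈ predLanguage L f q ∧ predLanguage L f q ≤ f i := by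
      rintro n rfl hn
      exact ⟨.invented n, .inr ⟨n, Set.mem_Iio.2 (by omega), rfl⟩, hn, ⟨hw, by simp⟩,
        fun v hv => hv.1⟩
    -- If the head is the first copy for `f i`, the second one serves in the body.
    by_cases h : p = .invented (2 * i)
    · refine key (2 * i + 1) (by omega) ?_
      rw [h, Ne, Pred.invented.injEq]
      omega
    · exact key (2 * i) (by omega) h

theorem ne_nil_of_mem_predLanguage {L : Language Bool} {f : ℕ → Language Bool} {m : ℕ} {q : Pred}
    (hq : q ∈ bodySyms m) {w : List Bool} (hw : w ∈ predLanguage L f q) : w ≠ [] := by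
  rintro rfl
  rcases hq with (rfl | rfl) | ⟨n, -, rfl⟩
  · exact List.cons_ne_nil _ _ (show [] = [false] from hw).symm
  · exact List.cons_ne_nil _ _ (show [] = [true] from hw).symm
  · exact absurd hw.2 (by simp)

/-- Strong induction on the length of `w`, for all symbols and all `x` at once: a split of `w`
supplies a valid chain clause whose body literals concern shorter words. -/
theorem predRel_prependElt {L : Language Bool} {f : ℕ → Language Bool} {m : ℕ}
    (hL : L ∈ f '' Set.Iio m)
    (hf : ∀ i < m, ∀ w ∈ f i, 2 ≤ w.length → SplitsIn (f '' Set.Iio m) (f i) w)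
    {M : Type} [lang.Structure M] (hM : IsModel M (vocabulary ∪ program L f m))
    (w : List Bool) {p : Pred} (hp : p ∈ insert .target (bodySyms m))
    (hw : w ∈ predLanguage L f p) (x : M) : PredRel p (prependElt w x) x := by
  induction hn : w.length using Nat.strong_induction_on generalizing w p x with
  | _ n ih =>
  subst hn
  have hzero : ∀ x : M, PredRel .zero (prependElt [false] x) x :=
    predRel_of_terminalClause (hM _ (.inl (.inr (.inl rfl))))
  have hone : ∀ x : M, PredRel .one (prependElt [true] x) x :=
    predRel_of_terminalClause (hM _ (.inl (.inl rfl)))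
  have hempty : ∀ x : M, PredRel .empty x x := fun x =>
    hM (seqClause .empty []) (.inl (.inr (.inr rfl))) (fun _ => x) (by simp [seqClause, seqBody])
  have hident : ∀ q ∈ backgroundSyms, predLanguage L f q ≤ L → ∀ y z : M,
      PredRel q y z → PredRel .target y z := fun q hq h y z hyz =>
    predRel_of_seqClause_one (hM _ (.inr (.inl ⟨q, hq, h, rfl⟩))) hyz
  have hchain : ∀ i < m, w ∈ f i → 2 ≤ w.length →
      p ∈ insert Pred.target (Pred.invented '' Set.Iio (2 * m)) →
      (∀ v ∈ f i, 2 ≤ v.length → v ∈ predLanguage L f p) → PredRel p (prependElt w x) x := by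
    intro i hi hwi hlen hp' hle
    obtain ⟨_, ⟨j, hj, rfl⟩, _, ⟨k, hk, rfl⟩, hjk, u, hu, v, hv, hu0, hv0, rfl⟩ :=
      hf i hi w hwi hlen
    have hne : p ≠ .zero ∧ p ≠ .one := by
      rcases hp' with rfl | ⟨n, -, rfl⟩ <;> simp
    obtain ⟨q, hq, hpq, huq, hqj⟩ := exists_bodySym L hj hu hu0 hne
    obtain ⟨r, hr, -, hvr, hrk⟩ := exists_bodySym L hk hv hv0 hne
    have hu1 := List.length_pos_iff.2 hu0
    have hv1 := List.length_pos_iff.2 hv0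
    rw [prependElt_append]
    refine predRel_of_seqClause_two
      (hM _ (.inr (.inr ⟨p, hp', q, hq, r, hr, hpq, ?_, rfl⟩)))
      (ih _ (by simp; omega) u (.inr hq) huq _ rfl) (ih _ (by simp; omega) v (.inr hr) hvr _ rfl)
    -- Validity of the chain clause: body symbols carry no empty word, so the products have length
    -- at least two, as an invented head requires.
    intro z hz
    obtain ⟨u', hu', v', hv', rfl⟩ := Language.mem_mul.1 hz
    have hu1' := List.length_pos_iff.2 (ne_nil_of_mem_predLanguage hq hu')
    have hv1' := List.length_pos_iff.2 (ne_nil_of_mem_predLanguage hr hv')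
    exact hle _ (hjk (Language.append_mem_mul (hqj hu') (hrk hv'))) (by simp; omega)
  have hsing : ∀ v : List Bool, v ∈ L → ({v} : Language Bool) ≤ L := by
    intro v hv v' hv'
    exact (show v' = v from hv') ▸ hv
  rcases hp with rfl | (rfl | rfl) | ⟨n, hn, rfl⟩
  · obtain ⟨i, hi, rfl⟩ := hL
    -- Words too short to split come from Identity, whose clause is in the program because the word
    -- is in the target language.
    match w, hw with
    | [], hw => exact hident .empty (by simp [backgroundSyms]) (hsing _ hw) _ _ (hempty x)
    | [false], hw => exact hident .zero (by simp [backgroundSyms]) (hsing _ hw) _ _ (hzero x)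
    | [true], hw => exact hident .one (by simp [backgroundSyms]) (hsing _ hw) _ _ (hone x)
    | _ :: _ :: _, hw => exact hchain i hi hw (by simp) (.inl rfl) fun v hv _ => hv
  · obtain rfl : w = [false] := hw
    exact hzero x
  · obtain rfl : w = [true] := hw
    exact hone x
  · have hn' : n < 2 * m := hn
    exact hchain (n / 2) (by omega) hw.1 hw.2 (.inr ⟨n, hn, rfl⟩) fun v hv hv' => ⟨hv, hv'⟩

/-! ## The normal form -/

theorem isSONF_metarules (narrow withTriChain : Bool) :
    IsSONF vocabulary (metarules narrow withTriChain) contextFreeInterps := by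
  rintro _ ⟨L, hL, rfl⟩
  obtain ⟨𝓛, hfin, hL𝓛, hsplit⟩ := exists_finite_splitsIn hL
  obtain ⟨f, m, rfl⟩ : ∃ (f : ℕ → Language Bool) (m : ℕ), 𝓛 = f '' Set.Iio m := by
    obtain ⟨m, e, he⟩ := hfin.fin_param
    -- The value `0` beyond `m` is a filler; only indices below `m` matter.
    refine ⟨fun i => if h : i < m then e ⟨i, h⟩ else 0, m, ?_⟩
    rw [← he.2]
    ext A
    constructor
    · rintro ⟨i, rfl⟩
      exact ⟨i, i.2, by simp⟩
    · rintro ⟨i, hi, rfl⟩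
      have hi' : i < m := hi
      exact ⟨⟨i, hi'⟩, by simp [hi']⟩
  have hvoc : vocabulary.Finite :=
    Set.toFinite {terminalClause Pred.one true, terminalClause Pred.zero false,
      seqClause Pred.empty []}
  refine ⟨program L f m, metaEntails_program narrow withTriChain L f m,
    hvoc.union (finite_program L f m), ?_, fun a ha h => ha (mem_languageInterp_of_entails h)⟩
  rintro ⟨t, u⟩ ⟨w, hw, ht⟩ M _ _ hM
  obtain rfl : t = prepend w u := ht
  have h := predRel_prependElt hL𝓛 (fun i hi => hsplit (f i) ⟨i, hi, rfl⟩) hM w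
    (p := .target) (.inl rfl) hw (u.realize Empty.elim)
  rw [← realize_prepend] at h
  exact h

theorem isDCG_of_metaEntails {narrow withTriChain : Bool} {H : Set Clause}
    (hH : MetaEntails (metarules narrow withTriChain) H) : IsDCG (vocabulary ∪ H) := by
  rintro c ((rfl | rfl | rfl) | hc)
  · exact .inr ⟨_, _, rfl⟩
  · exact .inr ⟨_, _, rfl⟩
  · exact .inl ⟨_, _, rfl⟩
  · obtain ⟨_, rfl | rfl | ⟨-, rfl⟩, θ, -, rfl⟩ := hH hc
    · exact .inl ⟨θ 0, [θ 1], rfl⟩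
    · exact .inl ⟨θ 0, [θ 1, θ 2], rfl⟩
    · exact .inl ⟨θ 0, [θ 1, θ 2, θ 3], rfl⟩

end CGNF

theorem mainTheorem2 (narrow withTriChain : Bool) :
    CGNF.IsSONF CGNF.vocabulary (CGNF.metarules narrow withTriChain) CGNF.contextFreeInterps ∧
    (∀ H : Set CGNF.Clause, CGNF.MetaEntails (CGNF.metarules narrow withTriChain) H →
      CGNF.IsDCG (CGNF.vocabulary ∪ H)) := by
  exact ⟨CGNF.isSONF_metarules narrow withTriChain,
    fun _ hH => CGNF.isDCG_of_metaEntails hH⟩
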